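/- Let $d\ge 1$ and $\alpha,\beta,\lambda\in(0,\infty)$. Consider inhomogeneous long-range percolation (scale-free percolation) on $\mathbb Z^d$: the weights $(W_x)_{x\in\mathbb Z^d}$ are i.i.d. with $\mathbb P[W_x>w]=w^{-\beta}$ for $w\ge 1$, and, conditionally given the weights, the undirected edges $\{x,y\}$, $x\neq y$, are independently occupied with probability $$p_{xy}=1-\exp\left(-\frac{\lambda W_xW_y}{|x-y|^{\alpha}}\right),$$ where $|\cdot|$ is the Euclidean norm. Let $d(x,y)\in\mathbb N_0\cup\{\infty\}$ be the graph distance, that is, the minimal number of occupied edges on a path of occupied edges connecting $x$ and $y$, with $d(x,y)=\infty$ if there is no such path. **Theorem 8 (b2).** If $\min\{\alpha,\beta\alpha\}>2d$, then there exists $\eta_2>0$ (which may depend on $d,\alpha,\beta,\lambda$) such that $$\lim_{|x|\to\infty}\mathbb P\left[\eta_2<\frac{d(0,x)}{|x|}\right]=1.$$ -/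

import Mathlib

open MeasureTheory ProbabilityTheory Filter Topology
open scoped ENNReal

namespace ScaleFreePercolation

/-- Euclidean norm `|x|` of a lattice point `x ∈ ℤ^d`. -/
noncomputable def latticeNorm {d : ℕ} (x : Fin d → ℤ) : ℝ :=
  ‖(WithLp.toLp 2 (fun i => (x i : ℝ)) : EuclideanSpace ℝ (Fin d))‖

/-- Law of the weights `(W_x)_{x ∈ ℤ^d}`: i.i.d. Pareto with scale `1` and shape `β > 0`, that is,
`P[W_x > w] = w^{-β}` for `w ≥ 1`. -/
noncomputable def weightLaw (d : ℕ) (β : ℝ) (hβ : 0 < β) : Measure ((Fin d → ℤ) → ℝ) :=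
  haveI : IsProbabilityMeasure (paretoMeasure 1 β) := isProbabilityMeasure_paretoMeasure one_pos hβ
  Measure.infinitePi fun _ : Fin d → ℤ => paretoMeasure 1 β

instance (d : ℕ) (β : ℝ) (hβ : 0 < β) : IsProbabilityMeasure (weightLaw d β hβ) := by
  have : IsProbabilityMeasure (paretoMeasure 1 β) := isProbabilityMeasure_paretoMeasure one_pos hβ
  unfold weightLaw
  infer_instance

/-- Conditional probability `p_{xy} = 1 - exp (-λ W_x W_y / |x - y|^α)` that the undirected edge
`{x, y}` is occupied, given the weights `W`. -/
noncomputable def edgeProb {d : ℕ} (α l : ℝ) (W : (Fin d → ℤ) → ℝ) (e : Sym2 (Fin d → ℤ)) : ℝ :=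
  Sym2.lift ⟨fun x y => 1 - Real.exp (-(l * W x * W y / latticeNorm (x - y) ^ α)), by
    intro x y
    have h : latticeNorm (x - y) = latticeNorm (y - x) := by
      unfold latticeNorm
      rw [← norm_neg]
      congr 1
      ext i
      simp
    simp only [h, mul_right_comm]⟩ e

/-- Law of the edge configuration given the weights `W`: the edges are independent, and `e` is
occupied (`true`) with probability `edgeProb α l W e`. The projection onto `[0, 1]` only matters
when some weight is negative, which happens with probability `0`. The diagonal elements of `Sym2`
are not edges of the graph below, so their state plays no role. -/
noncomputable def edgeLaw {d : ℕ} (α l : ℝ) (W : (Fin d → ℤ) → ℝ) :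
    Measure (Sym2 (Fin d → ℤ) → Bool) :=
  Measure.infinitePi fun e =>
    bernoulliMeasure true false (Set.projIcc (0 : ℝ) 1 zero_le_one (edgeProb α l W e))

instance {d : ℕ} (α l : ℝ) (W : (Fin d → ℤ) → ℝ) : IsProbabilityMeasure (edgeLaw α l W) := by
  unfold edgeLaw
  infer_instance

theorem measurable_edgeProb {d : ℕ} (α l : ℝ) (e : Sym2 (Fin d → ℤ)) :
    Measurable fun W : (Fin d → ℤ) → ℝ => edgeProb α l W e := by
  induction e using Sym2.ind with
  | _ x y =>
    simp only [edgeProb, Sym2.lift_mk]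
    fun_prop

theorem measurable_edgeLaw {d : ℕ} (α l : ℝ) :
    Measurable fun W : (Fin d → ℤ) → ℝ => edgeLaw α l W := by
  refine Measurable.measure_of_isPiSystem_of_isProbabilityMeasure
    (S := squareCylinders fun _ => {s : Set Bool | MeasurableSet s})
    generateFrom_squareCylinders.symm
    (isPiSystem_squareCylinders (fun _ => MeasurableSpace.isPiSystem_measurableSet) (by simp)) ?_
  rintro _ ⟨s, t, ht, rfl⟩
  simp only [edgeLaw]
  have hpi : ∀ W : (Fin d → ℤ) → ℝ, _ := fun W => Measure.infinitePi_pi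
    (μ := fun e => bernoulliMeasure true false
      (Set.projIcc (0 : ℝ) 1 zero_le_one (edgeProb α l W e))) (s := s) (t := t)
    (fun i _ => ht i (Set.mem_univ i))
  simp only [hpi]
  refine Finset.measurable_prod _ fun e _ => ?_
  have hp : Measurable fun W : (Fin d → ℤ) → ℝ =>
      Set.projIcc (0 : ℝ) 1 zero_le_one (edgeProb α l W e) :=
    continuous_projIcc.measurable.comp (measurable_edgeProb α l e)
  have h0 : Measurable fun p : unitInterval => bernoulliMeasure true false p (t e) := by
    have hm : MeasurableSet (t e) := ht e (Set.mem_univ e)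
    simp only [bernoulliMeasure_def, Measure.add_apply, Measure.smul_apply]
    refine Measurable.add ?_ ?_
    · exact ((measurable_subtype_coe.subtype_mk).coe_nnreal_ennreal).mul_const _
    · exact (((measurable_const.sub measurable_subtype_coe).subtype_mk).coe_nnreal_ennreal).mul_const _
  exact h0.comp hp

/-- The edge law as a Markov kernel from weights to edge configurations. -/
noncomputable def edgeKernel (d : ℕ) (α l : ℝ) :
    Kernel ((Fin d → ℤ) → ℝ) (Sym2 (Fin d → ℤ) → Bool) where
  toFun := edgeLaw α l
  measurable' := measurable_edgeLaw α l

instance (d : ℕ) (α l : ℝ) : IsMarkovKernel (edgeKernel d α l) :=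
  ⟨fun W => inferInstanceAs (IsProbabilityMeasure (edgeLaw α l W))⟩

/-- Joint law of the weights and the edge configuration of inhomogeneous long-range percolation on
`ℤ^d` with parameters `α`, `β` and `l` (the intensity, usually written `λ`). -/
noncomputable def law (d : ℕ) (α β l : ℝ) (hβ : 0 < β) :
    Measure (((Fin d → ℤ) → ℝ) × (Sym2 (Fin d → ℤ) → Bool)) :=
  weightLaw d β hβ ⊗ₘ edgeKernel d α l

instance (d : ℕ) (α β l : ℝ) (hβ : 0 < β) : IsProbabilityMeasure (law d α β l hβ) := by
  unfold law
  infer_instance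

/-- The random graph on `ℤ^d` whose edges are the occupied edges. -/
def occupiedGraph {d : ℕ} (ω : ((Fin d → ℤ) → ℝ) × (Sym2 (Fin d → ℤ) → Bool)) :
    SimpleGraph (Fin d → ℤ) :=
  SimpleGraph.fromEdgeSet {e | ω.2 e = true}

/-- The graph distance `d(x, y)`: the minimal number of occupied edges on a path from `x` to `y`,
and `∞` if there is no such path. -/
noncomputable def graphDist {d : ℕ} (ω : ((Fin d → ℤ) → ℝ) × (Sym2 (Fin d → ℤ) → Bool))
    (x y : Fin d → ℤ) : ℝ≥0∞ :=
  ((occupiedGraph ω).edist x y : ℝ≥0∞)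

end ScaleFreePercolation

/-!
A linear lower bound for the graph distance, by renormalization. The argument uses only two
properties of the model.

* After averaging over the weights, an edge `{x, y}` is occupied with probability at most
  `C ‖x - y‖ ^ (-s)` for some `s > 2d` (`exists_law_edge_le`). Hence a ball of
  radius `h ^ (1 + ε)`, with `ε` small, is unlikely to contain any edge longer than `h`.
* Edges that share a vertex are correlated through its weight, but events that depend on the edges
  inside disjoint finite regions are independent (`law_inter_localEvent`).

Call a ball of radius `3n` fast, at pace `η`, if it contains a path that covers a distance of at
least `n` with fewer than `η` edges per unit of distance (`FastCrossing`). Suppose that a ball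
at scale `n` has no edge longer than `h`, for some `h ≤ n`. Cut a path in it into pieces of
displacement between `h` and `2h`: each piece is slow if it starts near a slow ball at scale `h`.
If all fast balls at scale `h` are close to each other, the part of the path between its first and
its last visit to them has displacement of order `h`, and dropping it changes the pace by a factor
`1 - 13 h / n` only. So a fast ball at scale `n` requires either an edge longer than `h` or two
disjoint fast balls at scale `h` (`FastCrossing.exists_longEdge_or_pair`). With `q` a bound for the
probability of fast balls at scale `h`, independence bounds the latter by `(8 n / h) ^ (2d) q ^ 2`.

With `s = 2d + 2δ` and `h = ⌊n ^ θ⌋`, `θ < 1` close to `1`, these bounds close a strong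
induction on `n` showing that fast balls have probability at most `n ^ (-δ)`
(`exists_law_fastEvent_le`). The paces `η (1 + n ^ (-(1 - θ)))` absorb the losses, and the initial
scales are free, because for small `η` no path achieves this pace there. The induction reaches all
scales `n`, not just a sparse sequence, so it applies with `n = ⌊‖x‖⌋` to a path from `0`
to `x`; the path can leave the ball of radius `3n` prematurely only along an edge of length more
than `n`, which is unlikely as well (`exists_law_longEdgeEvent_le`).

The argument uses the sup norm on `ℤ^d`, which is comparable to the Euclidean norm.
-/

namespace ScaleFreePercolation

variable {d : ℕ}

/-! ### Boxes and nets -/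

/-- The lattice points at sup-norm distance at most `r` from `z`. -/
noncomputable def box (z : Fin d → ℤ) (r : ℕ) : Finset (Fin d → ℤ) :=
  Finset.Icc (fun i => z i - r) (fun i => z i + r)

theorem mem_box {z x : Fin d → ℤ} {r : ℕ} : x ∈ box z r ↔ ‖x - z‖ ≤ r := by
  rw [box, Finset.mem_Icc, Pi.le_def, Pi.le_def, ← forall_and,
    pi_norm_le_iff_of_nonneg (by positivity)]
  refine forall_congr' fun i => ?_
  rw [Pi.sub_apply, Int.norm_eq_abs, ← Int.cast_abs, ← Int.cast_natCast (R := ℝ), Int.cast_le,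
    abs_le]
  constructor <;> rintro ⟨h1, h2⟩ <;> constructor <;> lia

theorem card_box (z : Fin d → ℤ) (r : ℕ) : (box z r).card = (2 * r + 1) ^ d := by
  rw [box, Pi.card_Icc]
  simp only [Int.card_Icc]
  rw [Finset.prod_congr rfl (g := fun _ => 2 * r + 1) (fun i _ => by lia)]
  simp

/-- The point of the sublattice `(h ℤ)^d` obtained by rounding down every coordinate of `x`. -/
def roundDown (h : ℕ) (x : Fin d → ℤ) : Fin d → ℤ := fun i => h * (x i / h)

theorem norm_sub_roundDown_le {h : ℕ} (hh : 1 ≤ h) (x : Fin d → ℤ) :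
    ‖x - roundDown h x‖ ≤ h := by
  rw [pi_norm_le_iff_of_nonneg (by positivity)]
  intro i
  have h0 : (0 : ℤ) < h := by lia
  rw [Pi.sub_apply, Int.norm_eq_abs, ← Int.cast_abs, ← Int.cast_natCast (R := ℝ), Int.cast_le,
    abs_le,
    roundDown]
  have h1 := Int.emod_add_mul_ediv (x i) h
  have h2 := Int.emod_nonneg (x i) h0.ne'
  have h3 := Int.emod_lt_of_pos (x i) h0
  constructor <;> lia

/-- The sublattice points `roundDown h x` with `x` in the box of radius `r` around `z`. -/
noncomputable def net (h : ℕ) (z : Fin d → ℤ) (r : ℕ) : Finset (Fin d → ℤ) :=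
  (box z r).image (roundDown h)

theorem card_net_le {h r : ℕ} (hh : 1 ≤ h) (z : Fin d → ℤ) :
    ((net h z r).card : ℝ) ≤ (2 * r / h + 2) ^ d := by
  have h0 : (0 : ℤ) < h := by lia
  have hsub : net h z r ⊆ (Finset.Icc (fun i => (z i - r) / (h : ℤ))
      (fun i => (z i + r) / (h : ℤ))).image (fun j i => h * j i) := by
    intro w hw
    obtain ⟨x, hx, rfl⟩ := Finset.mem_image.1 hw
    rw [box, Finset.mem_Icc] at hx
    refine Finset.mem_image.2 ⟨fun i => x i / h, Finset.mem_Icc.2 ⟨fun i => ?_, fun i => ?_⟩, rfl⟩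
    · exact Int.ediv_le_ediv h0 (hx.1 i)
    · exact Int.ediv_le_ediv h0 (hx.2 i)
  have hcard := (Finset.card_le_card hsub).trans Finset.card_image_le
  rw [Pi.card_Icc] at hcard
  have hcard' : ((net h z r).card : ℝ) ≤
      ∏ i : Fin d, ((Finset.Icc ((z i - r) / (h : ℤ)) ((z i + r) / (h : ℤ))).card : ℝ) := by
    exact_mod_cast hcard
  refine hcard'.trans ?_
  have hpos : (0 : ℝ) < h := by exact_mod_cast hh
  calc _ ≤ ∏ _i : Fin d, (2 * r / h + 2 : ℝ) := by
        refine Finset.prod_le_prod (fun _ _ => by positivity) fun i _ => ?_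
        rw [Int.card_Icc]
        have e1 := Int.emod_add_mul_ediv (z i - r) h
        have e2 := Int.emod_lt_of_pos (z i - r) h0
        have e3 := Int.emod_add_mul_ediv (z i + r) h
        have e4 := Int.emod_nonneg (z i + r) h0.ne'
        have hmono : (z i - r) / (h : ℤ) ≤ (z i + r) / (h : ℤ) := Int.ediv_le_ediv h0 (by lia)
        have hc : ((((z i + r) / (h : ℤ) + 1 - (z i - r) / (h : ℤ)).toNat : ℤ)) =
            (z i + r) / (h : ℤ) + 1 - (z i - r) / (h : ℤ) := Int.toNat_of_nonneg (by lia)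
        generalize (z i + r) / (h : ℤ) = b at *
        generalize (z i - r) / (h : ℤ) = a at *
        have hz : (h : ℤ) * (b - a) ≤ 2 * r + h := by
          rw [mul_sub]; lia
        have hr : (h : ℝ) * (b - a) ≤ 2 * r + h := by exact_mod_cast hz
        have hc' : (((b + 1 - a).toNat : ℝ)) = b + 1 - a := by exact_mod_cast hc
        rw [hc']
        have : (b : ℝ) - a ≤ 2 * r / h + 1 := by
          rw [div_add_one hpos.ne', le_div_iff₀ hpos]; linarith
        linarith
    _ = _ := by simp

/-! ### Deterministic renormalization of fast crossings -/

/-- Some path of `G` inside the ball of radius `3h` around `z` has a displacement of at least `h`,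
but fewer edges than `η` times this displacement. The path is the restriction of `γ` to the
indices between `i` and `j`, so that subpaths need no reindexing. -/
def FastCrossing (G : SimpleGraph (Fin d → ℤ)) (η : ℝ) (h : ℕ) (z : Fin d → ℤ) : Prop :=
  ∃ (γ : ℕ → Fin d → ℤ) (i j : ℕ), i ≤ j ∧ (∀ k, i ≤ k → k ≤ j → ‖γ k - z‖ ≤ 3 * h) ∧
    (∀ k, i ≤ k → k < j → G.Adj (γ k) (γ (k + 1))) ∧ h ≤ ‖γ i - γ j‖ ∧
      (j : ℝ) - i < η * ‖γ i - γ j‖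

theorem FastCrossing.mono {G : SimpleGraph (Fin d → ℤ)} {η η' : ℝ} {h : ℕ} {z : Fin d → ℤ}
    (hη : η ≤ η') (hf : FastCrossing G η h z) : FastCrossing G η' h z := by
  obtain ⟨γ, i, j, hij, hball, hadj, hdisp, hlen⟩ := hf
  exact ⟨γ, i, j, hij, hball, hadj, hdisp,
    hlen.trans_le (mul_le_mul_of_nonneg_right hη (norm_nonneg _))⟩

/-- A positive displacement takes at least one edge, and it is at most `6h` inside a ball of
radius `3h`; so no path is fast at a pace `η ≤ 1 / (6h)`. -/
theorem not_fastCrossing_of_le {G : SimpleGraph (Fin d → ℤ)} {η : ℝ} {h : ℕ} {z : Fin d → ℤ}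
    (hh : 1 ≤ h) (hη : 0 ≤ η) (hη' : η * (6 * h) ≤ 1) : ¬ FastCrossing G η h z := by
  rintro ⟨γ, i, j, hij, hball, -, hdisp, hlen⟩
  have h1 : (1 : ℝ) ≤ h := by exact_mod_cast hh
  have hle : ‖γ i - γ j‖ ≤ 6 * h := by
    have := norm_sub_le_norm_sub_add_norm_sub (γ i) z (γ j)
    rw [norm_sub_rev z] at this
    linarith [hball i le_rfl hij, hball j hij le_rfl]
  have hlt : (j : ℝ) - i < 1 := hlen.trans_le ((mul_le_mul_of_nonneg_left hle hη).trans hη')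
  have : j = i := by
    have : (j : ℝ) < i + 1 := by linarith
    have : j < i + 1 := by exact_mod_cast this
    lia
  subst this
  simp at hdisp
  lia

/-- A path all of whose edges have length at most `h`, and all of whose vertices except possibly
the last one are near a point without fast crossing, cannot be fast. The path is cut each time it
has moved by more than `h`; every piece lies in one of the balls without fast crossing. -/
theorem le_length_of_forall_not_fastCrossing {G : SimpleGraph (Fin d → ℤ)} {η : ℝ} (hη : 0 ≤ η)
    {h : ℕ} (hh : 1 ≤ h) (γ : ℕ → Fin d → ℤ) {i j : ℕ} (hij : i ≤ j)
    (hadj : ∀ k, i ≤ k → k < j → G.Adj (γ k) (γ (k + 1)))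
    (hshort : ∀ k, i ≤ k → k < j → ‖γ k - γ (k + 1)‖ ≤ h)
    (hslow : ∀ k, i ≤ k → k < j → ¬ FastCrossing G η h (roundDown h (γ k))) :
    η * (‖γ i - γ j‖ - 2 * h) ≤ (j : ℝ) - i := by
  induction hn : j - i using Nat.strong_induction_on generalizing i with
  | _ n ih =>
  have h1 : (1 : ℝ) ≤ h := by exact_mod_cast hh
  have hji : (0 : ℝ) ≤ (j : ℝ) - i := by
    have : (i : ℝ) ≤ j := by exact_mod_cast hij
    linarith
  by_cases hsmall : ‖γ i - γ j‖ ≤ 2 * h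
  · exact (mul_nonpos_of_nonneg_of_nonpos hη (by linarith)).trans hji
  push Not at hsmall
  have hex : ∃ k, i ≤ k ∧ (h : ℝ) < ‖γ i - γ k‖ := ⟨j, hij, by linarith⟩
  classical
  obtain ⟨hk1, hk2⟩ := Nat.find_spec hex
  have hkj : Nat.find hex ≤ j := Nat.find_min' hex ⟨hij, by linarith⟩
  have hmin : ∀ m, i ≤ m → m < Nat.find hex → ‖γ i - γ m‖ ≤ h := fun m him hm =>
    not_lt.1 fun hlt => Nat.find_min hex hm ⟨him, hlt⟩
  generalize Nat.find hex = k at *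
  have hik : i < k := by
    rcases hk1.eq_or_lt with rfl | hlt
    · simp at hk2
      linarith
    · exact hlt
  have hk3 : ‖γ i - γ k‖ ≤ 2 * h := by
    have e := norm_sub_le_norm_sub_add_norm_sub (γ i) (γ (k - 1)) (γ k)
    have e1 := hmin (k - 1) (by lia) (by lia)
    have e2 := hshort (k - 1) (by lia) (by lia)
    rw [Nat.sub_add_cancel (by lia)] at e2
    linarith
  have hpiece : η * ‖γ i - γ k‖ ≤ (k : ℝ) - i := by
    by_contra hcon
    push Not at hcon
    refine hslow i le_rfl (by lia) ⟨γ, i, k, hk1, fun m him hmk => ?_,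
      fun m him hmk => hadj m him (by lia), hk2.le, hcon⟩
    have e : ‖γ i - γ m‖ ≤ 2 * h := by
      rcases hmk.eq_or_lt with rfl | hlt
      · exact hk3
      · linarith [hmin m him hlt]
    have e1 := norm_sub_le_norm_sub_add_norm_sub (γ m) (γ i) (roundDown h (γ i))
    have e2 := norm_sub_roundDown_le hh (γ i)
    rw [norm_sub_rev (γ m) (γ i)] at e1
    linarith
  have hrest := ih (j - k) (by lia) hkj (fun m hm => hadj m (by lia))
    (fun m hm => hshort m (by lia)) (fun m hm => hslow m (by lia)) rfl
  have htri := norm_sub_le_norm_sub_add_norm_sub (γ i) (γ k) (γ j)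
  nlinarith [mul_le_mul_of_nonneg_left htri hη]

/-- Fast crossings at scale `h` do little harm if they are all close to each other: the part of the
path between the first and the last vertex near one of them has displacement at most `8h` and is
discarded. -/
theorem le_length_of_pairwise_close {G : SimpleGraph (Fin d → ℤ)} {η : ℝ} (hη : 0 ≤ η)
    {h : ℕ} (hh : 1 ≤ h) (γ : ℕ → Fin d → ℤ) {i j : ℕ} (hij : i ≤ j)
    (hadj : ∀ k, i ≤ k → k < j → G.Adj (γ k) (γ (k + 1)))
    (hshort : ∀ k, i ≤ k → k < j → ‖γ k - γ (k + 1)‖ ≤ h)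
    (hclose : ∀ k l, i ≤ k → k ≤ j → i ≤ l → l ≤ j → FastCrossing G η h (roundDown h (γ k)) →
      FastCrossing G η h (roundDown h (γ l)) → ‖roundDown h (γ k) - roundDown h (γ l)‖ ≤ 6 * h) :
    η * (‖γ i - γ j‖ - 13 * h) ≤ (j : ℝ) - i := by
  classical
  have h1 : (1 : ℝ) ≤ h := by exact_mod_cast hh
  set B := (Finset.Icc i j).filter fun k => FastCrossing G η h (roundDown h (γ k)) with hB
  have memB : ∀ k, k ∈ B ↔ (i ≤ k ∧ k ≤ j) ∧ FastCrossing G η h (roundDown h (γ k)) := by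
    simp [hB]
  rcases B.eq_empty_or_nonempty with hemp | hne
  · have := le_length_of_forall_not_fastCrossing hη hh γ hij hadj hshort fun k hk hkj hf => by
      have : k ∈ B := (memB k).2 ⟨⟨hk, hkj.le⟩, hf⟩
      simp [hemp] at this
    nlinarith
  · have ha := (memB _).1 (B.min'_mem hne)
    have hb := (memB _).1 (B.max'_mem hne)
    have hab : B.min' hne ≤ B.max' hne := B.min'_le _ (B.max'_mem hne)
    have hmin : ∀ k ∈ B, B.min' hne ≤ k := fun k hk => B.min'_le k hk
    have hmax : ∀ k ∈ B, k ≤ B.max' hne := fun k hk => B.le_max' k hk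
    generalize B.min' hne = a at *
    generalize B.max' hne = b at *
    obtain ⟨⟨hia, haj⟩, hfa⟩ := ha
    obtain ⟨⟨hib, hbj⟩, hfb⟩ := hb
    have hfirst := le_length_of_forall_not_fastCrossing hη hh γ hia
      (fun k hk hka => hadj k hk (by lia)) (fun k hk hka => hshort k hk (by lia))
      fun k hk hka hf => by
        have := hmin k ((memB k).2 ⟨⟨hk, by lia⟩, hf⟩)
        lia
    have hlast : η * (‖γ b - γ j‖ - 3 * h) ≤ (j : ℝ) - b := by
      rcases hbj.eq_or_lt with rfl | hlt
      · simp only [sub_self, norm_zero]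
        nlinarith
      · have e := le_length_of_forall_not_fastCrossing hη hh γ (i := b + 1) hlt
          (fun k hk hkj => hadj k (by lia) hkj) (fun k hk hkj => hshort k (by lia) hkj)
          fun k hk hkj hf => by
            have := hmax k ((memB k).2 ⟨⟨by lia, hkj.le⟩, hf⟩)
            lia
        have e1 := hshort b hib hlt
        have e2 := norm_sub_le_norm_sub_add_norm_sub (γ b) (γ (b + 1)) (γ j)
        push_cast at e
        have e3 : ‖γ b - γ j‖ - 3 * h ≤ ‖γ (b + 1) - γ j‖ - 2 * h := by linarith
        linarith [mul_le_mul_of_nonneg_left e3 hη]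
    have hmid : ‖γ a - γ b‖ ≤ 8 * h := by
      have e := hclose a b hia haj hib hbj hfa hfb
      have e1 := norm_sub_roundDown_le hh (γ a)
      have e2 := norm_sub_roundDown_le hh (γ b)
      have e3 := norm_sub_le_norm_sub_add_norm_sub (γ a) (roundDown h (γ a)) (γ b)
      have e4 := norm_sub_le_norm_sub_add_norm_sub (roundDown h (γ a)) (roundDown h (γ b)) (γ b)
      rw [norm_sub_rev (roundDown h (γ b)) (γ b)] at e4
      linarith
    have t1 := norm_sub_le_norm_sub_add_norm_sub (γ i) (γ a) (γ j)
    have t2 := norm_sub_le_norm_sub_add_norm_sub (γ a) (γ b) (γ j)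
    have t3 : ‖γ i - γ j‖ - 13 * h ≤ (‖γ i - γ a‖ - 2 * h) + (‖γ b - γ j‖ - 3 * h) := by linarith
    have t4 : (a : ℝ) ≤ b := by exact_mod_cast hab
    have t5 := mul_le_mul_of_nonneg_left t3 hη
    rw [mul_add] at t5
    linarith

/-- The renormalization step: a fast crossing at scale `n` forces a long edge, or two fast
crossings at the smaller scale `h`, at a slightly larger `η`, in disjoint balls. -/
theorem FastCrossing.exists_longEdge_or_pair {G : SimpleGraph (Fin d → ℤ)} {η : ℝ} (hη : 0 ≤ η)
    {h n : ℕ} (hh : 1 ≤ h) (hn : 1 ≤ n) {z : Fin d → ℤ}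
    (hf : FastCrossing G (η * (1 - 13 * h / n)) n z) :
    (∃ x ∈ box z (3 * n), ∃ y ∈ box z (3 * n), (h : ℝ) < ‖x - y‖ ∧ G.Adj x y) ∨
    ∃ w ∈ net h z (3 * n), ∃ w' ∈ net h z (3 * n), 6 * (h : ℝ) < ‖w - w'‖ ∧
      FastCrossing G η h w ∧ FastCrossing G η h w' := by
  by_contra! hcon
  obtain ⟨hedge, hpair⟩ := hcon
  obtain ⟨γ, i, j, hij, hball, hadj, hdisp, hlen⟩ := hf
  have hbox : ∀ k, i ≤ k → k ≤ j → γ k ∈ box z (3 * n) := fun k hk hkj =>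
    mem_box.2 (by push_cast; exact hball k hk hkj)
  have hnet : ∀ k, i ≤ k → k ≤ j → roundDown h (γ k) ∈ net h z (3 * n) := fun k hk hkj =>
    Finset.mem_image_of_mem _ (hbox k hk hkj)
  have key := le_length_of_pairwise_close hη hh γ hij hadj
    (fun k hk hkj => not_lt.1 fun hlt =>
      hedge _ (hbox k hk hkj.le) _ (hbox (k + 1) (by lia) hkj) hlt (hadj k hk hkj))
    (fun k l hk hkj hl hlj hfk hfl => not_lt.1 fun hlt =>
      hpair _ (hnet k hk hkj) _ (hnet l hl hlj) hlt hfk hfl)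
  have hnpos : (0 : ℝ) < n := by exact_mod_cast hn
  have e : (13 * h : ℝ) ≤ 13 * h / n * ‖γ i - γ j‖ := by
    rw [div_mul_eq_mul_div, le_div_iff₀ hnpos]
    exact mul_le_mul_of_nonneg_left hdisp (by positivity)
  nlinarith [mul_le_mul_of_nonneg_left e hη]

/-! ### Independence of local events -/

theorem edgeProb_congr {α l : ℝ} {W W' : (Fin d → ℤ) → ℝ} {A : Finset (Fin d → ℤ)}
    (hW : ∀ x ∈ A, W x = W' x) {e : Sym2 (Fin d → ℤ)} (he : e ∈ A.sym2) :
    edgeProb α l W e = edgeProb α l W' e := by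
  induction e using Sym2.ind with
  | _ x y =>
    rw [Finset.mk_mem_sym2_iff] at he
    simp only [edgeProb, Sym2.lift_mk, hW x he.1, hW y he.2]

/-- The configurations whose restriction to the edges with both endpoints in `A` lies in `T`. -/
def localEvent (A : Finset (Fin d → ℤ)) (T : Set (A.sym2 → Bool)) :
    Set (Sym2 (Fin d → ℤ) → Bool) :=
  A.sym2.restrict ⁻¹' T

theorem measurableSet_localEvent (A : Finset (Fin d → ℤ)) (T : Set (A.sym2 → Bool)) :
    MeasurableSet (localEvent A T) :=
  Finset.measurable_restrict _ (Set.toFinite T).measurableSet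

/-- Given the weights, the probability of a local event only depends on the weights in the same
region. -/
theorem edgeLaw_localEvent_congr {α l : ℝ} {W W' : (Fin d → ℤ) → ℝ} {A : Finset (Fin d → ℤ)}
    (hW : ∀ x ∈ A, W x = W' x) (T : Set (A.sym2 → Bool)) :
    edgeLaw α l W (localEvent A T) = edgeLaw α l W' (localEvent A T) := by
  have hT : MeasurableSet T := (Set.toFinite T).measurableSet
  rw [localEvent, ← Measure.map_apply (Finset.measurable_restrict _) hT,
    ← Measure.map_apply (Finset.measurable_restrict _) hT, edgeLaw, edgeLaw,
    Measure.infinitePi_map_restrict, Measure.infinitePi_map_restrict]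
  congr 2
  ext1 e
  rw [edgeProb_congr hW e.2]

theorem edgeLaw_inter_localEvent {α l : ℝ} (W : (Fin d → ℤ) → ℝ) {A B : Finset (Fin d → ℤ)}
    (hAB : Disjoint A B) (S : Set (A.sym2 → Bool)) (T : Set (B.sym2 → Bool)) :
    edgeLaw α l W (localEvent A S ∩ localEvent B T) =
      edgeLaw α l W (localEvent A S) * edgeLaw α l W (localEvent B T) := by
  have hdisj : Disjoint A.sym2 B.sym2 := by
    rw [Finset.disjoint_left] at hAB ⊢
    intro e
    induction e using Sym2.ind with
    | _ x y =>
      rw [Finset.mk_mem_sym2_iff, Finset.mk_mem_sym2_iff]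
      exact fun h1 h2 => hAB h1.1 h2.1
  have hind : iIndepFun (fun (e : Sym2 (Fin d → ℤ)) (σ : Sym2 (Fin d → ℤ) → Bool) => σ e)
      (edgeLaw α l W) :=
    iIndepFun_infinitePi (X := fun _ b => b) fun _ => measurable_id
  have hind' := hind.indepFun_finset A.sym2 B.sym2 hdisj fun e => measurable_pi_apply e
  exact hind'.measure_inter_preimage_eq_mul _ _
    (Set.toFinite S).measurableSet (Set.toFinite T).measurableSet

theorem law_preimage_snd {α β l : ℝ} (hβ : 0 < β) {E : Set (Sym2 (Fin d → ℤ) → Bool)}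
    (hE : MeasurableSet E) :
    law d α β l hβ (Prod.snd ⁻¹' E) = ∫⁻ W, edgeLaw α l W E ∂weightLaw d β hβ := by
  rw [law, Measure.compProd_apply (measurable_snd hE)]
  rfl

/-- The weights in disjoint regions are independent. -/
theorem indepFun_restrict_weightLaw {β : ℝ} (hβ : 0 < β) {A B : Finset (Fin d → ℤ)}
    (hAB : Disjoint A B) :
    IndepFun (A.restrict : ((Fin d → ℤ) → ℝ) → A → ℝ) B.restrict (weightLaw d β hβ) := by
  have : IsProbabilityMeasure (paretoMeasure 1 β) := isProbabilityMeasure_paretoMeasure one_pos hβ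
  have hind : iIndepFun (fun (x : Fin d → ℤ) (W : (Fin d → ℤ) → ℝ) => W x)
      (weightLaw d β hβ) :=
    iIndepFun_infinitePi (X := fun _ b => b) fun _ => measurable_id
  exact hind.indepFun_finset A B hAB fun e => measurable_pi_apply e

/-- Events that depend on the edges inside disjoint regions are independent, even though edges
sharing an endpoint are correlated through the weights. -/
theorem law_inter_localEvent {α β l : ℝ} (hβ : 0 < β) {A B : Finset (Fin d → ℤ)}
    (hAB : Disjoint A B) (S : Set (A.sym2 → Bool)) (T : Set (B.sym2 → Bool)) :
    law d α β l hβ (Prod.snd ⁻¹' (localEvent A S ∩ localEvent B T)) =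
      law d α β l hβ (Prod.snd ⁻¹' localEvent A S) *
        law d α β l hβ (Prod.snd ⁻¹' localEvent B T) := by
  classical
  have hS := measurableSet_localEvent A S
  have hT := measurableSet_localEvent B T
  rw [law_preimage_snd hβ (hS.inter hT), law_preimage_snd hβ hS, law_preimage_snd hβ hT]
  simp only [edgeLaw_inter_localEvent _ hAB]
  let ext (C : Finset (Fin d → ℤ)) (w : C → ℝ) : (Fin d → ℤ) → ℝ :=
    fun x => if hx : x ∈ C then w ⟨x, hx⟩ else 0
  have hext : ∀ C, Measurable (ext C) := fun C => by
    refine measurable_pi_lambda _ fun x => ?_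
    by_cases hx : x ∈ C
    · simpa only [ext, hx, dite_true] using measurable_pi_apply (⟨x, hx⟩ : C)
    · simpa only [ext, hx, dite_false] using measurable_const
  have hmeas : ∀ (C : Finset (Fin d → ℤ)) (U : Set (C.sym2 → Bool)),
      Measurable fun w : C → ℝ => edgeLaw α l (ext C w) (localEvent C U) := fun C U =>
    (Measure.measurable_coe (measurableSet_localEvent C U)).comp
      ((measurable_edgeLaw α l).comp (hext C))
  have heq : ∀ (C : Finset (Fin d → ℤ)) (U : Set (C.sym2 → Bool)) (W : (Fin d → ℤ) → ℝ),
      edgeLaw α l W (localEvent C U) = edgeLaw α l (ext C (C.restrict W)) (localEvent C U) :=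
    fun C U W => edgeLaw_localEvent_congr (fun x hx => by simp [ext, hx]) U
  rw [lintegral_congr (heq A S), lintegral_congr (heq B T),
    lintegral_congr fun W => congrArg₂ (· * ·) (heq A S W) (heq B T W)]
  exact lintegral_mul_eq_lintegral_mul_lintegral_of_indepFun''
    ((hmeas A S).comp (Finset.measurable_restrict A)).aemeasurable
    ((hmeas B T).comp (Finset.measurable_restrict B)).aemeasurable
    ((indepFun_restrict_weightLaw hβ hAB).comp (hmeas A S) (hmeas B T))

/-- The set of configurations with a fast crossing of the ball of radius `3h` around `z`. -/
def fastEvent (η : ℝ) (h : ℕ) (z : Fin d → ℤ) :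
    Set (((Fin d → ℤ) → ℝ) × (Sym2 (Fin d → ℤ) → Bool)) :=
  {ω | FastCrossing (occupiedGraph ω) η h z}

theorem occupiedGraph_adj {ω : ((Fin d → ℤ) → ℝ) × (Sym2 (Fin d → ℤ) → Bool)} {x y : Fin d → ℤ} :
    (occupiedGraph ω).Adj x y ↔ ω.2 s(x, y) = true ∧ x ≠ y := by
  rw [occupiedGraph, SimpleGraph.fromEdgeSet_adj]
  rfl

/-- Fast crossings are local events. -/
theorem exists_fastEvent_eq (η : ℝ) (h : ℕ) (z : Fin d → ℤ) :
    ∃ T, fastEvent η h z = Prod.snd ⁻¹' localEvent (box z (3 * h)) T := by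
  refine ⟨{σ | FastCrossing
    (SimpleGraph.fromEdgeSet {e | ∃ he : e ∈ (box z (3 * h)).sym2, σ ⟨e, he⟩ = true}) η h z}, ?_⟩
  ext ω
  change FastCrossing _ _ _ _ ↔ FastCrossing _ _ _ _
  have hbox : ∀ (γ : ℕ → Fin d → ℤ) (i j : ℕ), (∀ k, i ≤ k → k ≤ j → ‖γ k - z‖ ≤ 3 * h) →
      ∀ k, i ≤ k → k < j → s(γ k, γ (k + 1)) ∈ (box z (3 * h)).sym2 := fun γ i j hb k hk hkj => by
    rw [Finset.mk_mem_sym2_iff, mem_box, mem_box]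
    push_cast
    exact ⟨hb k hk hkj.le, hb (k + 1) (by lia) hkj⟩
  constructor
  · rintro ⟨γ, i, j, hij, hball, hadj, hrest⟩
    refine ⟨γ, i, j, hij, hball, fun k hk hkj => ?_, hrest⟩
    have := occupiedGraph_adj.1 (hadj k hk hkj)
    rw [SimpleGraph.fromEdgeSet_adj]
    exact ⟨⟨hbox γ i j hball k hk hkj, this.1⟩, this.2⟩
  · rintro ⟨γ, i, j, hij, hball, hadj, hrest⟩
    refine ⟨γ, i, j, hij, hball, fun k hk hkj => ?_, hrest⟩
    have := hadj k hk hkj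
    rw [SimpleGraph.fromEdgeSet_adj] at this
    obtain ⟨⟨_, h1⟩, h2⟩ := this
    exact occupiedGraph_adj.2 ⟨h1, h2⟩

theorem law_fastEvent_inter {α β l : ℝ} (hβ : 0 < β) {η : ℝ} {h : ℕ} {w w' : Fin d → ℤ}
    (hw : 6 * (h : ℝ) < ‖w - w'‖) :
    (law d α β l hβ).real (fastEvent η h w ∩ fastEvent η h w') =
      (law d α β l hβ).real (fastEvent η h w) * (law d α β l hβ).real (fastEvent η h w') := by
  have hdisj : Disjoint (box w (3 * h)) (box w' (3 * h)) := by
    rw [Finset.disjoint_left]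
    intro x hx hx'
    rw [mem_box] at hx hx'
    have e := norm_sub_le_norm_sub_add_norm_sub w x w'
    rw [norm_sub_rev w x] at e
    push_cast at hx hx'
    linarith
  obtain ⟨S, hS⟩ := exists_fastEvent_eq η h w
  obtain ⟨T, hT⟩ := exists_fastEvent_eq η h w'
  rw [hS, hT, ← Set.preimage_inter, measureReal_def, law_inter_localEvent hβ hdisj,
    ENNReal.toReal_mul]
  rfl

/-! ### Decay of the edge probabilities -/

theorem norm_le_latticeNorm (x : Fin d → ℤ) : ‖x‖ ≤ latticeNorm x := by
  rw [pi_norm_le_iff_of_nonneg (r := latticeNorm x) (norm_nonneg _)]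
  intro i
  have := PiLp.norm_apply_le (WithLp.toLp 2 (fun i => (x i : ℝ)) : EuclideanSpace ℝ (Fin d)) i
  rwa [PiLp.toLp_apply, Real.norm_eq_abs, ← Int.norm_eq_abs] at this

theorem latticeNorm_le (x : Fin d → ℤ) : latticeNorm x ≤ d * ‖x‖ := by
  rw [latticeNorm, EuclideanSpace.norm_eq]
  refine Real.sqrt_le_iff.2 ⟨by positivity, ?_⟩
  calc _ ≤ ∑ _i : Fin d, ‖x‖ ^ 2 := Finset.sum_le_sum fun i _ => by
        rw [PiLp.toLp_apply, Real.norm_eq_abs, ← Int.norm_eq_abs]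
        gcongr
        exact norm_le_pi_norm x i
    _ = d * ‖x‖ ^ 2 := by simp
    _ ≤ (d * ‖x‖) ^ 2 := by
        rw [mul_pow]
        gcongr
        exact_mod_cast Nat.le_self_pow two_ne_zero d

theorem one_sub_exp_neg_le_abs_rpow (u : ℝ) {t : ℝ} (ht0 : 0 ≤ t) (ht1 : t ≤ 1) :
    1 - Real.exp (-u) ≤ |u| ^ t := by
  have h1 : 1 - Real.exp (-u) ≤ |u| := by
    linarith [Real.add_one_le_exp (-u), le_abs_self u]
  rcases le_total |u| 1 with h | h
  · calc _ ≤ |u| := h1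
      _ = |u| ^ (1 : ℝ) := (Real.rpow_one _).symm
      _ ≤ |u| ^ t := Real.rpow_le_rpow_of_exponent_ge' (abs_nonneg u) h ht0 ht1
  · linarith [Real.one_le_rpow h ht0, Real.exp_pos (-u)]

/-- The Pareto law of shape `β` has finite moments of all orders below `β`. -/
theorem lintegral_abs_rpow_paretoMeasure_lt_top {β t : ℝ} (ht : t < β) :
    ∫⁻ w, ENNReal.ofReal (|w| ^ t) ∂paretoMeasure 1 β < ∞ := by
  rw [paretoMeasure, lintegral_withDensity_eq_lintegral_mul _ (by
    unfold paretoPDF; exact (measurable_paretoPDFReal 1 β).ennreal_ofReal) (by fun_prop)]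
  have hint : IntegrableOn (fun w : ℝ => w ^ (t - (β + 1))) (Set.Ioi 1) :=
    integrableOn_Ioi_rpow_of_lt (by linarith) one_pos
  have hlt : ∫⁻ w in Set.Ici (1 : ℝ), ENNReal.ofReal |β| * ENNReal.ofReal (w ^ (t - (β + 1))) < ∞ := by
    rw [setLIntegral_congr Ioi_ae_eq_Ici.symm, lintegral_const_mul _ (by fun_prop)]
    refine ENNReal.mul_lt_top ENNReal.ofReal_lt_top ?_
    have := hint.hasFiniteIntegral
    refine lt_of_le_of_lt (lintegral_mono fun w => ?_) this
    rw [← ofReal_norm]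
    exact ENNReal.ofReal_le_ofReal (le_abs_self _)
  refine lt_of_le_of_lt ?_ hlt
  rw [← lintegral_indicator measurableSet_Ici]
  refine lintegral_mono fun w => ?_
  by_cases hw : 1 ≤ w
  · rw [Set.indicator_of_mem (Set.mem_Ici.2 hw), Pi.mul_apply, paretoPDF_of_le hw,
      ← ENNReal.ofReal_mul' (by positivity), ← ENNReal.ofReal_mul (by positivity)]
    have hw0 : 0 < w := by linarith
    refine ENNReal.ofReal_le_ofReal ?_
    rw [abs_of_pos hw0, Real.one_rpow, mul_one, mul_assoc, ← Real.rpow_add hw0,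
      show -(β + 1) + t = t - (β + 1) by ring]
    exact mul_le_mul_of_nonneg_right (le_abs_self β) (by positivity)
  · rw [Pi.mul_apply, paretoPDF_of_lt (not_le.1 hw), zero_mul]
    exact zero_le

theorem edgeLaw_edge_le {α l : ℝ} (W : (Fin d → ℤ) → ℝ) (e : Sym2 (Fin d → ℤ)) :
    edgeLaw α l W {σ | σ e = true} ≤ ENNReal.ofReal (edgeProb α l W e) := by
  have h1 : edgeLaw α l W {σ | σ e = true} = (edgeLaw α l W).map (fun σ => σ e) {true} := by
    rw [Measure.map_apply (measurable_pi_apply e) (measurableSet_singleton _)]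
    rfl
  classical
  rw [h1, edgeLaw, Measure.infinitePi_map_eval, bernoulliMeasure_apply _ (measurableSet_singleton _)]
  simp only [Set.mem_singleton_iff, Bool.false_eq_true, if_true, if_false]
  have h2 : edgeProb α l W e ≤ 1 := by
    induction e using Sym2.ind with
    | _ x y =>
      simp only [edgeProb, Sym2.lift_mk]
      linarith [Real.exp_pos (-(l * W x * W y / latticeNorm (x - y) ^ α))]
  rw [← ENNReal.ofReal_coe_nnreal]
  change ENNReal.ofReal (max 0 (min 1 (edgeProb α l W e))) ≤ _
  rw [min_eq_right h2, ENNReal.ofReal_max, ENNReal.ofReal_zero, max_eq_right zero_le]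

/-- After averaging over the weights, long edges are rare: the exponent of the decay exceeds
`2d`. Interpolating between the bounds `1` and `u` for `1 - exp (-u)` by the power `u ^ t`, with
`t ≤ 1` and `t < β`, turns the hypothesis on `α` and `β` into such a decay. -/
theorem exists_law_edge_le {α β l : ℝ} (hα : 0 < α) (hβ : 0 < β) (hl : 0 < l)
    (h : 2 * (d : ℝ) < min α (β * α)) :
    ∃ C s : ℝ, 0 ≤ C ∧ 2 * (d : ℝ) < s ∧ ∀ x y : Fin d → ℤ, x ≠ y →
      (law d α β l hβ).real {ω | (occupiedGraph ω).Adj x y} ≤ C * ‖x - y‖ ^ (-s) := by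
  have : IsProbabilityMeasure (paretoMeasure 1 β) := isProbabilityMeasure_paretoMeasure one_pos hβ
  obtain ⟨hα', hβ'⟩ := lt_min_iff.1 h
  obtain ⟨t, ht1, ht2⟩ : ∃ t, 2 * (d : ℝ) / α < t ∧ t < min 1 β := by
    refine exists_between (lt_min ?_ ?_)
    · rwa [div_lt_one hα]
    · rwa [div_lt_iff₀ hα]
  obtain ⟨ht2, ht3⟩ := lt_min_iff.1 ht2
  have ht0 : 0 < t := lt_of_le_of_lt (by positivity) ht1
  have hs : 2 * (d : ℝ) < t * α := (div_lt_iff₀ hα).1 ht1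
  set M := ∫⁻ w, ENNReal.ofReal (|w| ^ t) ∂paretoMeasure 1 β with hM
  have hMtop : M < ∞ := lintegral_abs_rpow_paretoMeasure_lt_top ht3
  refine ⟨l ^ t * (M.toReal * M.toReal), t * α, by positivity, hs, fun x y hxy => ?_⟩
  have hr : 0 < ‖x - y‖ := norm_pos_iff.2 (sub_ne_zero.2 hxy)
  have hwt : ∀ z : Fin d → ℤ, ∫⁻ W, ENNReal.ofReal (|W z| ^ t) ∂weightLaw d β hβ = M := fun z => by
    rw [hM, ← Measure.infinitePi_map_eval (fun _ : Fin d → ℤ => paretoMeasure 1 β) z,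
      lintegral_map (by fun_prop) (measurable_pi_apply z)]
    rfl
  have hind : IndepFun (fun W : (Fin d → ℤ) → ℝ => W x) (fun W => W y) (weightLaw d β hβ) :=
    (iIndepFun_infinitePi (P := fun _ : Fin d → ℤ => paretoMeasure 1 β)
      (X := fun _ b => b) fun _ => measurable_id).indepFun hxy
  have hφ : Measurable fun w : ℝ => ENNReal.ofReal (|w| ^ t) := by fun_prop
  have hprod : ∫⁻ W, ENNReal.ofReal (|W x| ^ t) * ENNReal.ofReal (|W y| ^ t) ∂weightLaw d β hβ
      = M * M := by
    have := lintegral_mul_eq_lintegral_mul_lintegral_of_indepFun''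
      (hφ.comp (measurable_pi_apply x)).aemeasurable
      (hφ.comp (measurable_pi_apply y)).aemeasurable (hind.comp hφ hφ)
    simp only [Function.comp_apply] at this
    rw [this, hwt, hwt]
  have hpt : ∀ W : (Fin d → ℤ) → ℝ, edgeLaw α l W {σ | σ s(x, y) = true} ≤
      ENNReal.ofReal (l ^ t * ‖x - y‖ ^ (-(t * α))) *
        (ENNReal.ofReal (|W x| ^ t) * ENNReal.ofReal (|W y| ^ t)) := fun W => by
    refine (edgeLaw_edge_le W _).trans ?_
    rw [← ENNReal.ofReal_mul (by positivity), ← ENNReal.ofReal_mul (by positivity)]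
    refine ENNReal.ofReal_le_ofReal ?_
    simp only [edgeProb, Sym2.lift_mk]
    refine (one_sub_exp_neg_le_abs_rpow _ ht0.le ht2.le).trans ?_
    have hL : 0 < latticeNorm (x - y) := hr.trans_le (norm_le_latticeNorm _)
    rw [abs_div, abs_mul, abs_mul, abs_of_pos hl, abs_of_pos (Real.rpow_pos_of_pos hL α),
      Real.div_rpow (by positivity) (by positivity), Real.mul_rpow (by positivity) (by positivity),
      Real.mul_rpow (by positivity) (by positivity), ← Real.rpow_mul hL.le, mul_comm α t,
      div_eq_mul_inv, ← Real.rpow_neg hL.le]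
    have := Real.rpow_le_rpow_of_nonpos hr (norm_le_latticeNorm (x - y))
      (z := -(t * α)) (by nlinarith)
    calc _ ≤ l ^ t * |W x| ^ t * |W y| ^ t * ‖x - y‖ ^ (-(t * α)) := by gcongr
      _ = _ := by ring
  have hset : {ω : ((Fin d → ℤ) → ℝ) × (Sym2 (Fin d → ℤ) → Bool) | (occupiedGraph ω).Adj x y} =
      Prod.snd ⁻¹' {σ | σ s(x, y) = true} := by
    ext ω
    exact occupiedGraph_adj.trans (and_iff_left hxy)
  have hmeas : MeasurableSet {σ : Sym2 (Fin d → ℤ) → Bool | σ s(x, y) = true} :=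
    (measurable_pi_apply (X := fun _ : Sym2 (Fin d → ℤ) => Bool) s(x, y))
      (measurableSet_singleton true)
  have hle : law d α β l hβ {ω | (occupiedGraph ω).Adj x y} ≤
      ENNReal.ofReal (l ^ t * ‖x - y‖ ^ (-(t * α))) * (M * M) := by
    rw [hset, law_preimage_snd hβ hmeas]
    refine (lintegral_mono hpt).trans ?_
    rw [lintegral_const_mul _ (by fun_prop), hprod]
  refine (ENNReal.toReal_mono (ENNReal.mul_ne_top ENNReal.ofReal_ne_top
    (ENNReal.mul_ne_top hMtop.ne hMtop.ne)) hle).trans ?_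
  rw [ENNReal.toReal_mul, ENNReal.toReal_ofReal (by positivity), ENNReal.toReal_mul]
  exact le_of_eq (by ring)

theorem summable_norm_rpow {r : ℝ} (hr : r < -d) :
    Summable fun z : Fin d → ℤ => ‖z‖ ^ r := by
  set L := Submodule.span ℤ (Set.range (Pi.basisFun ℝ (Fin d))) with hL
  have hmem : ∀ z : Fin d → ℤ, (fun i => (z i : ℝ)) ∈ L := fun z => by
    rw [hL, Module.Basis.mem_span_iff_repr_mem]
    exact fun i => ⟨z i, by simp⟩
  have hrank : Module.finrank ℤ L = d := by
    rw [ZLattice.rank ℝ L]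
    simp
  have hsum := ZLattice.summable_norm_rpow L r (by rw [hrank]; exact hr)
  have hinj : Function.Injective fun z : Fin d → ℤ => (⟨fun i => (z i : ℝ), hmem z⟩ : L) := by
    intro z w hzw
    ext i
    have : (z i : ℝ) = w i := congrFun (congrArg Subtype.val hzw) i
    exact_mod_cast this
  refine (hsum.comp_injective hinj).congr fun z => ?_
  rfl

/-! ### Probability bounds at all scales -/

/-- Probabilistic form of the renormalization step. The square of `q` comes from the independence
of the two fast crossings at scale `h`; this gain beats the number of pairs of balls. -/
theorem law_fastEvent_le_of_forall_le {α β l : ℝ} (hβ : 0 < β) {C s : ℝ} (hC : 0 ≤ C)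
    (hs : 0 ≤ s) (hedge : ∀ x y : Fin d → ℤ, x ≠ y →
      (law d α β l hβ).real {ω | (occupiedGraph ω).Adj x y} ≤ C * ‖x - y‖ ^ (-s))
    {η q : ℝ} (hη : 0 ≤ η) {h n : ℕ} (hh : 1 ≤ h) (hhn : h ≤ n)
    (hq : ∀ w, (law d α β l hβ).real (fastEvent η h w) ≤ q) (z : Fin d → ℤ) :
    (law d α β l hβ).real (fastEvent (η * (1 - 13 * h / n)) n z) ≤
      (7 * n : ℝ) ^ (2 * d) * (C * (h : ℝ) ^ (-s)) + (8 * n / h : ℝ) ^ (2 * d) * q ^ 2 := by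
  classical
  set μ := law d α β l hβ
  have hn : 1 ≤ n := hh.trans hhn
  have hhR : (1 : ℝ) ≤ h := by exact_mod_cast hh
  have hhnR : (h : ℝ) ≤ n := by exact_mod_cast hhn
  have hh0 : (0 : ℝ) < h := by linarith
  set P := (box z (3 * n) ×ˢ box z (3 * n)).filter fun p => (h : ℝ) < ‖p.1 - p.2‖ with hP
  set Q := (net h z (3 * n) ×ˢ net h z (3 * n)).filter fun p => 6 * (h : ℝ) < ‖p.1 - p.2‖ with hQ
  have hq0 : 0 ≤ q := measureReal_nonneg.trans (hq 0)
  have hsub : fastEvent (η * (1 - 13 * h / n)) n z ⊆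
      (⋃ p ∈ P, {ω | (occupiedGraph ω).Adj p.1 p.2}) ∪
        ⋃ p ∈ Q, fastEvent η h p.1 ∩ fastEvent η h p.2 := by
    intro ω hω
    rcases FastCrossing.exists_longEdge_or_pair hη hh hn hω with
      ⟨x, hx, y, hy, hxy, hadj⟩ | ⟨w, hw, w', hw', hww, hf, hf'⟩
    · refine Or.inl (Set.mem_biUnion (x := (x, y)) ?_ hadj)
      exact Finset.mem_filter.2 ⟨Finset.mem_product.2 ⟨hx, hy⟩, hxy⟩
    · refine Or.inr (Set.mem_biUnion (x := (w, w')) ?_ ⟨hf, hf'⟩)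
      exact Finset.mem_filter.2 ⟨Finset.mem_product.2 ⟨hw, hw'⟩, hww⟩
  have hPcard : (P.card : ℝ) ≤ (7 * n : ℝ) ^ (2 * d) := by
    have h1 : P.card ≤ (7 * n) ^ (2 * d) := by
      refine (Finset.card_filter_le _ _).trans ?_
      rw [Finset.card_product, card_box, ← pow_add, ← two_mul]
      exact Nat.pow_le_pow_left (by lia) _
    exact_mod_cast h1
  have hQcard : (Q.card : ℝ) ≤ (8 * n / h : ℝ) ^ (2 * d) := by
    have h1 : (Q.card : ℝ) ≤ (net h z (3 * n)).card * (net h z (3 * n)).card := by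
      exact_mod_cast (Finset.card_filter_le _ _).trans (Finset.card_product _ _).le
    have h2 : ((net h z (3 * n)).card : ℝ) ≤ (8 * n / h : ℝ) ^ d := by
      refine (card_net_le hh z).trans (pow_le_pow_left₀ (by positivity) ?_ d)
      rw [div_add' _ _ _ hh0.ne']
      push_cast
      gcongr
      linarith
    refine h1.trans ?_
    rw [two_mul, pow_add]
    gcongr
  refine (measureReal_mono hsub).trans ((measureReal_union_le _ _).trans (add_le_add ?_ ?_))
  · refine (measureReal_biUnion_finset_le _ _).trans ?_
    refine (Finset.sum_le_card_nsmul P _ (C * (h : ℝ) ^ (-s)) fun p hp => ?_).trans ?_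
    · have hp2 := (Finset.mem_filter.1 hp).2
      have hne : p.1 ≠ p.2 := fun heq => by
        rw [heq, sub_self, norm_zero] at hp2
        linarith
      refine (hedge _ _ hne).trans (mul_le_mul_of_nonneg_left ?_ hC)
      exact Real.rpow_le_rpow_of_nonpos hh0 hp2.le (by linarith)
    · rw [nsmul_eq_mul]
      gcongr
  · refine (measureReal_biUnion_finset_le _ _).trans ?_
    refine (Finset.sum_le_card_nsmul Q _ (q ^ 2) fun p hp => ?_).trans ?_
    · rw [law_fastEvent_inter hβ (Finset.mem_filter.1 hp).2, sq]
      exact mul_le_mul (hq _) (hq _) measureReal_nonneg hq0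
    · rw [nsmul_eq_mul]
      gcongr

/-- The arithmetic behind the choice of scales. With `s = 2 (d + δ)` and
`θ = (2 d + 3 δ / 2) / (2 d + 2 δ)`, the scale `h = ⌊n ^ θ⌋` turns a failure probability `h ^ (-δ)`
into `n ^ (-δ)`. -/
theorem eventually_scale_bound (d : ℕ) {C δ θ : ℝ} (hC : 0 ≤ C) (hδ : 0 < δ)
    (hθ : (2 * d + 2 * δ) * θ = 2 * d + 3 / 2 * δ) :
    ∀ᶠ n : ℕ in atTop, ∀ h : ℕ, (n : ℝ) ^ θ / 2 ≤ h →
      (7 * n : ℝ) ^ (2 * d) * (C * (h : ℝ) ^ (-(2 * d + 2 * δ))) +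
        (8 * n / h : ℝ) ^ (2 * d) * ((h : ℝ) ^ (-δ)) ^ 2 ≤ (n : ℝ) ^ (-δ) := by
  set A : ℝ := 7 ^ (2 * d) * C * (2 : ℝ) ^ (2 * d + 2 * δ) with hA
  set B : ℝ := 16 ^ (2 * d) * ((2 : ℝ) ^ δ) ^ 2 with hB
  have hlim : Tendsto (fun n : ℕ => (A + B) * (n : ℝ) ^ (-(δ / 2))) atTop (𝓝 ((A + B) * 0)) :=
    ((tendsto_rpow_neg_atTop (half_pos hδ)).comp tendsto_natCast_atTop_atTop).const_mul _
  rw [mul_zero] at hlim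
  filter_upwards [hlim.eventually_le_const one_pos, eventually_ge_atTop 1] with n hn hn1 h hh
  have hx : (0 : ℝ) < n := by exact_mod_cast hn1
  have hy : 0 < (n : ℝ) ^ θ / 2 := by positivity
  generalize (n : ℝ) = x at *
  have hh0 : (0 : ℝ) < h := hy.trans_le hh
  have hdn : x ^ (2 * d) = x ^ (2 * (d : ℝ)) := by
    rw [← Real.rpow_natCast]
    push_cast
    rfl
  have hhalf : ∀ a : ℝ, 0 ≤ a → (h : ℝ) ^ (-a) ≤ 2 ^ a * x ^ (-(a * θ)) := fun a ha => by
    calc (h : ℝ) ^ (-a) ≤ (x ^ θ / 2) ^ (-a) := Real.rpow_le_rpow_of_nonpos hy hh (by linarith)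
      _ = 2 ^ a * x ^ (-(a * θ)) := by
        rw [Real.div_rpow (by positivity) (by positivity), ← Real.rpow_mul hx.le,
          Real.rpow_neg (by norm_num : (0 : ℝ) ≤ 2), div_inv_eq_mul, mul_comm,
          show θ * -a = -(a * θ) by ring]
  have h1 : (7 * x) ^ (2 * d) * (C * (h : ℝ) ^ (-(2 * d + 2 * δ))) ≤ A * x ^ (-(3 / 2 * δ)) := by
    calc _ ≤ (7 * x) ^ (2 * d) *
          (C * (2 ^ (2 * d + 2 * δ) * x ^ (-((2 * d + 2 * δ) * θ)))) := by
          gcongr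
          exact hhalf _ (by positivity)
      _ = A * (x ^ (2 * (d : ℝ)) * x ^ (-((2 * d + 2 * δ) * θ))) := by
          rw [mul_pow, hdn, hA]
          ring
      _ = _ := by
          rw [← Real.rpow_add hx, hθ]
          congr 2
          ring
  have h2 : (8 * x / h) ^ (2 * d) * ((h : ℝ) ^ (-δ)) ^ 2 ≤ B * x ^ (-(3 / 2 * δ)) := by
    have hratio : 8 * x / h ≤ 16 * x ^ (1 - θ) := by
      calc 8 * x / h ≤ 8 * x / (x ^ θ / 2) := by gcongr
        _ = 16 * x ^ (1 - θ) := by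
          rw [Real.rpow_sub hx, Real.rpow_one]
          field_simp
          norm_num
    calc _ ≤ (16 * x ^ (1 - θ)) ^ (2 * d) * (2 ^ δ * x ^ (-(δ * θ))) ^ 2 := by
          gcongr
          exact hhalf _ hδ.le
      _ = B * (x ^ ((1 - θ) * (2 * d)) * x ^ (-(δ * θ) * 2)) := by
          rw [mul_pow, mul_pow, ← Real.rpow_natCast (x ^ (1 - θ)), ← Real.rpow_mul hx.le,
            ← Real.rpow_natCast (x ^ (-(δ * θ))), ← Real.rpow_mul hx.le, hB]
          push_cast
          ring
      _ = _ := by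
          rw [← Real.rpow_add hx]
          congr 2
          linear_combination -hθ
  calc _ ≤ A * x ^ (-(3 / 2 * δ)) + B * x ^ (-(3 / 2 * δ)) := add_le_add h1 h2
    _ = ((A + B) * x ^ (-(δ / 2))) * x ^ (-δ) := by
        rw [mul_assoc (A + B), ← Real.rpow_add hx, ← add_mul]
        congr 2
        ring
    _ ≤ 1 * x ^ (-δ) := by gcongr
    _ = _ := one_mul _

/-- The paces `1 + n ^ (-κ)` with `κ = 1 - θ` absorb the relative loss `13 h / n` of the
renormalization step from the scale `h ≤ n ^ θ` to the scale `n`, and stay bounded below. -/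
theorem eventually_pace_bound {θ : ℝ} (hθ : θ < 1) :
    ∀ᶠ n : ℕ in atTop, ∀ h : ℕ, 1 ≤ h → (h : ℝ) ≤ (n : ℝ) ^ θ →
      1 + (n : ℝ) ^ (-(1 - θ)) ≤ (1 + (h : ℝ) ^ (-(1 - θ))) * (1 - 13 * h / n) := by
  have hκ : 0 < 1 - θ := by linarith
  have hlim : Tendsto (fun n : ℕ => 27 * (n : ℝ) ^ (-((1 - θ) * (1 - θ)))) atTop (𝓝 (27 * 0)) :=
    ((tendsto_rpow_neg_atTop (mul_pos hκ hκ)).comp tendsto_natCast_atTop_atTop).const_mul _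
  rw [mul_zero] at hlim
  filter_upwards [hlim.eventually_le_const one_pos, eventually_ge_atTop 1] with n hn hn1 h hh hhn
  have hx : (0 : ℝ) < n := by exact_mod_cast hn1
  generalize (n : ℝ) = x at *
  have hh1 : (1 : ℝ) ≤ h := by exact_mod_cast hh
  have hh0 : (0 : ℝ) < h := by linarith
  have ha : x ^ (-(θ * (1 - θ))) ≤ (h : ℝ) ^ (-(1 - θ)) := by
    calc x ^ (-(θ * (1 - θ))) = (x ^ θ) ^ (-(1 - θ)) := by
          rw [← Real.rpow_mul hx.le]
          congr 1
          ring
      _ ≤ _ := Real.rpow_le_rpow_of_nonpos hh0 hhn (by linarith)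
  have ha1 : (h : ℝ) ^ (-(1 - θ)) ≤ 1 := Real.rpow_le_one_of_one_le_of_nonpos hh1 (by linarith)
  have hr : (h : ℝ) / x ≤ x ^ (-(1 - θ)) := by
    rw [div_le_iff₀ hx]
    calc (h : ℝ) ≤ x ^ θ := hhn
      _ = x ^ (-(1 - θ)) * x := by
        rw [← Real.rpow_add_one hx.ne']
        congr 1
        ring
  have hr0 : 0 ≤ (h : ℝ) / x := by positivity
  have hv : 27 * x ^ (-(1 - θ)) ≤ x ^ (-(θ * (1 - θ))) := by
    calc 27 * x ^ (-(1 - θ))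
        = (27 * x ^ (-((1 - θ) * (1 - θ)))) * x ^ (-(θ * (1 - θ))) := by
          rw [mul_assoc, ← Real.rpow_add hx]
          congr 2
          ring
      _ ≤ 1 * x ^ (-(θ * (1 - θ))) := by gcongr
      _ = _ := one_mul _
  rw [mul_div_assoc]
  nlinarith [mul_le_mul_of_nonneg_left ha1 hr0]

/-- At some positive pace `η`, fast crossings have polynomially small probability at all scales. -/
theorem exists_law_fastEvent_le {α β l : ℝ} (hβ : 0 < β) {C δ : ℝ} (hC : 0 ≤ C) (hδ : 0 < δ)
    (hedge : ∀ x y : Fin d → ℤ, x ≠ y → (law d α β l hβ).real {ω | (occupiedGraph ω).Adj x y} ≤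
      C * ‖x - y‖ ^ (-(2 * d + 2 * δ))) :
    ∃ η : ℝ, 0 < η ∧ ∀ n : ℕ, 1 ≤ n → ∀ z : Fin d → ℤ,
      (law d α β l hβ).real (fastEvent η n z) ≤ (n : ℝ) ^ (-δ) := by
  have hD : 0 < 2 * (d : ℝ) + 2 * δ := by positivity
  obtain ⟨θ, hθ⟩ : ∃ θ, (2 * d + 2 * δ) * θ = 2 * d + 3 / 2 * δ :=
    ⟨(2 * d + 3 / 2 * δ) / (2 * d + 2 * δ), mul_div_cancel₀ _ hD.ne'⟩
  have hθ0 : 0 < θ := by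
    by_contra hcon
    have : 0 < 2 * (d : ℝ) + 3 / 2 * δ := by positivity
    nlinarith
  have hθ1 : θ < 1 := by
    by_contra hcon
    nlinarith
  have hbig : ∀ᶠ n : ℕ in atTop, (2 : ℝ) ≤ (n : ℝ) ^ θ :=
    ((tendsto_rpow_atTop hθ0).comp tendsto_natCast_atTop_atTop).eventually_ge_atTop 2
  obtain ⟨N, hN⟩ := eventually_atTop.1 ((eventually_scale_bound d hC hδ hθ).and
    ((eventually_pace_bound hθ1).and (hbig.and (eventually_ge_atTop 2))))
  -- Below scale `N` this pace is too small for fast crossings to exist at all.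
  set η : ℝ := 1 / (12 * (N + 1)) with hη
  have hη0 : 0 < η := by positivity
  have key : ∀ n : ℕ, 1 ≤ n → ∀ z : Fin d → ℤ,
      (law d α β l hβ).real (fastEvent (η * (1 + (n : ℝ) ^ (-(1 - θ)))) n z) ≤ (n : ℝ) ^ (-δ) := by
    intro n
    induction n using Nat.strong_induction_on with
    | _ n ih =>
    intro hn z
    have hnR : (1 : ℝ) ≤ n := by exact_mod_cast hn
    rcases lt_or_ge n N with hnN | hnN
    · have hemp : fastEvent (η * (1 + (n : ℝ) ^ (-(1 - θ)))) n z = ∅ := by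
        refine Set.eq_empty_of_forall_notMem fun ω => not_fastCrossing_of_le hn (by positivity) ?_
        have h1 : (n : ℝ) ^ (-(1 - θ)) ≤ 1 :=
          Real.rpow_le_one_of_one_le_of_nonpos hnR (by linarith)
        have h2 : (n : ℝ) ≤ N + 1 := by
          have : (n : ℝ) < N := by exact_mod_cast hnN
          linarith
        calc _ ≤ η * (1 + 1) * (6 * (N + 1)) := by gcongr
          _ = 1 := by
            rw [hη]
            field_simp
            norm_num
      rw [hemp, measureReal_empty]
      positivity
    · obtain ⟨hscale, hpace, hy2, hn2⟩ := hN n hnN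
      have hfl : ((⌊(n : ℝ) ^ θ⌋₊ : ℕ) : ℝ) ≤ (n : ℝ) ^ θ := Nat.floor_le (by positivity)
      have hfl' := Nat.lt_floor_add_one ((n : ℝ) ^ θ)
      generalize ⌊(n : ℝ) ^ θ⌋₊ = h at hfl hfl'
      have hh : 1 ≤ h := by
        have : (1 : ℝ) < h + 1 := by linarith
        have : 1 < h + 1 := by exact_mod_cast this
        lia
      have hhn : h < n := by
        have h1 : (1 : ℝ) < n := by exact_mod_cast (by lia : 1 < n)
        have h2 : (n : ℝ) ^ θ < n := by
          simpa using Real.rpow_lt_rpow_of_exponent_lt h1 hθ1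
        exact_mod_cast hfl.trans_lt h2
      have hsub : fastEvent (η * (1 + (n : ℝ) ^ (-(1 - θ)))) n z ⊆
          fastEvent (η * (1 + (h : ℝ) ^ (-(1 - θ))) * (1 - 13 * h / n)) n z := fun ω hω =>
        FastCrossing.mono (by
          rw [mul_assoc]
          exact mul_le_mul_of_nonneg_left (hpace h hh hfl) hη0.le) hω
      refine (measureReal_mono hsub).trans ?_
      refine (law_fastEvent_le_of_forall_le hβ hC hD.le hedge (by positivity) hh hhn.le
        (ih h hhn hh) z).trans ?_
      exact hscale h (by linarith)
  refine ⟨η, hη0, fun n hn z => (measureReal_mono fun ω hω => ?_).trans (key n hn z)⟩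
  refine FastCrossing.mono (le_mul_of_one_le_right hη0.le ?_) hω
  exact le_add_of_nonneg_right (by positivity)

/-! ### Paths from the origin to a distant point -/

/-- The set of configurations with an edge of length more than `n` that has an endpoint in the ball
of radius `3n` around the origin. The other endpoint may be anywhere. -/
def longEdgeEvent (d n : ℕ) : Set (((Fin d → ℤ) → ℝ) × (Sym2 (Fin d → ℤ) → Bool)) :=
  {ω | ∃ x ∈ box (0 : Fin d → ℤ) (3 * n), ∃ y, (n : ℝ) < ‖x - y‖ ∧ (occupiedGraph ω).Adj x y}

theorem exists_law_longEdgeEvent_le {α β l : ℝ} (hβ : 0 < β) {C δ : ℝ} (hC : 0 ≤ C) (hδ : 0 < δ)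
    (hedge : ∀ x y : Fin d → ℤ, x ≠ y → (law d α β l hβ).real {ω | (occupiedGraph ω).Adj x y} ≤
      C * ‖x - y‖ ^ (-(2 * d + 2 * δ))) :
    ∃ K : ℝ, ∀ n : ℕ, 1 ≤ n →
      (law d α β l hβ).real (longEdgeEvent d n) ≤ K * (n : ℝ) ^ (-δ) := by
  set μ := law d α β l hβ
  -- Half of the surplus `2δ` of the decay makes the sum over the far endpoint converge.
  have hsum : Summable fun z : Fin d → ℤ => ‖z‖ ^ (-(d + δ)) := summable_norm_rpow (by linarith)
  set S := ∑' z : Fin d → ℤ, ‖z‖ ^ (-(d + δ)) with hS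
  refine ⟨7 ^ d * (C * S), fun n hn => ?_⟩
  have hx : (1 : ℝ) ≤ n := by exact_mod_cast hn
  have hx0 : (0 : ℝ) < n := by linarith
  have hpoint : ∀ x : Fin d → ℤ,
      μ.real {ω | ∃ y, (n : ℝ) < ‖x - y‖ ∧ (occupiedGraph ω).Adj x y} ≤
        C * (n : ℝ) ^ (-(d + δ)) * S := fun x => by
    have hterm : ∀ y : Fin d → ℤ, μ {ω | (n : ℝ) < ‖x - y‖ ∧ (occupiedGraph ω).Adj x y} ≤
        ENNReal.ofReal (C * (n : ℝ) ^ (-(d + δ)) * ‖x - y‖ ^ (-(d + δ))) := fun y => by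
      by_cases hxy : (n : ℝ) < ‖x - y‖
      · have hr : 0 < ‖x - y‖ := hx0.trans hxy
        have hne : x ≠ y := sub_ne_zero.1 (norm_pos_iff.1 hr)
        have h1 : μ {ω | (n : ℝ) < ‖x - y‖ ∧ (occupiedGraph ω).Adj x y} =
            ENNReal.ofReal (μ.real {ω | (occupiedGraph ω).Adj x y}) := by
          simp only [hxy, true_and]
          exact (ofReal_measureReal (measure_ne_top μ _)).symm
        rw [h1]
        refine ENNReal.ofReal_le_ofReal ((hedge x y hne).trans ?_)
        rw [show -(2 * d + 2 * δ) = -(d + δ) + -(d + δ) by ring, Real.rpow_add hr, ← mul_assoc]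
        gcongr ?_ * _
        refine mul_le_mul_of_nonneg_left ?_ hC
        exact Real.rpow_le_rpow_of_nonpos hx0 hxy.le (by linarith [Nat.cast_nonneg (α := ℝ) d])
      · simp [hxy]
    have hsum' : Summable fun y : Fin d → ℤ => ‖x - y‖ ^ (-(d + δ)) :=
      (Equiv.subLeft x).summable_iff.2 hsum
    have hS' : ∑' y : Fin d → ℤ, ‖x - y‖ ^ (-(d + δ)) = S :=
      (Equiv.subLeft x).tsum_eq fun z : Fin d → ℤ => ‖z‖ ^ (-(d + δ))
    have hle : μ {ω | ∃ y, (n : ℝ) < ‖x - y‖ ∧ (occupiedGraph ω).Adj x y} ≤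
        ENNReal.ofReal (C * (n : ℝ) ^ (-(d + δ)) * S) := by
      rw [Set.ofPred_exists]
      refine (measure_iUnion_le _).trans ((ENNReal.tsum_le_tsum hterm).trans ?_)
      rw [← ENNReal.ofReal_tsum_of_nonneg (fun y => by positivity) (hsum'.mul_left _),
        tsum_mul_left, hS']
    exact ENNReal.toReal_le_of_le_ofReal
      (mul_nonneg (by positivity) (tsum_nonneg fun z => by positivity)) hle
  have hset : longEdgeEvent d n ⊆ ⋃ x ∈ box (0 : Fin d → ℤ) (3 * n),
      {ω | ∃ y, (n : ℝ) < ‖x - y‖ ∧ (occupiedGraph ω).Adj x y} := by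
    rintro ω ⟨x, hx, y, hy⟩
    exact Set.mem_biUnion hx ⟨y, hy⟩
  refine (measureReal_mono hset (measure_ne_top μ _)).trans
    ((measureReal_biUnion_finset_le _ _).trans ?_)
  refine (Finset.sum_le_card_nsmul _ _ _ fun x _ => hpoint x).trans ?_
  have hS0 : 0 ≤ S := tsum_nonneg fun z => by positivity
  have hcard : ((box (0 : Fin d → ℤ) (3 * n)).card : ℝ) ≤ (7 * n : ℝ) ^ d := by
    have : (box (0 : Fin d → ℤ) (3 * n)).card ≤ (7 * n) ^ d := by
      rw [card_box]
      exact Nat.pow_le_pow_left (by lia) _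
    exact_mod_cast this
  rw [nsmul_eq_mul]
  calc _ ≤ (7 * n : ℝ) ^ d * (C * (n : ℝ) ^ (-(d + δ)) * S) := by gcongr
    _ = 7 ^ d * (C * S) * ((n : ℝ) ^ (d : ℝ) * (n : ℝ) ^ (-(d + δ))) := by
        rw [mul_pow, Real.rpow_natCast]
        ring
    _ = _ := by
        rw [← Real.rpow_add hx0]
        congr 2
        ring

/-- If a short path leads from the origin to a point at distance about `n`, then there is a fast
crossing at scale `n`, unless an edge of length more than `n` leads out of the ball of
radius `3n`: a path leaving that ball along a shorter edge has travelled at least `2n` before. -/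
theorem mem_fastEvent_or_mem_longEdgeEvent
    {ω : ((Fin d → ℤ) → ℝ) × (Sym2 (Fin d → ℤ) → Bool)} {η : ℝ} (hη : 0 ≤ η) {n : ℕ}
    {x : Fin d → ℤ} (hxn : n ≤ ‖x‖)
    (p : (occupiedGraph ω).Walk 0 x) (hp : (p.length : ℝ) < η * n) :
    ω ∈ fastEvent η n 0 ∪ longEdgeEvent d n := by
  classical
  by_contra hcon
  rw [Set.mem_union, not_or] at hcon
  obtain ⟨hslow, hshort⟩ := hcon
  have hstay : ∀ k, k ≤ p.length → ∀ m, m ≤ k → ‖p.getVert m‖ ≤ 3 * n := by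
    by_contra! hex
    obtain ⟨_, hk, m, hmk, hm⟩ := hex
    have hex' : ∃ m, m ≤ p.length ∧ 3 * (n : ℝ) < ‖p.getVert m‖ := ⟨m, hmk.trans hk, hm⟩
    obtain ⟨h1, h2⟩ := Nat.find_spec hex'
    have hmin : ∀ m, m < Nat.find hex' → ‖p.getVert m‖ ≤ 3 * n := fun m hm =>
      not_lt.1 fun hlt => Nat.find_min hex' hm ⟨by lia, hlt⟩
    generalize Nat.find hex' = a at *
    cases a with
    | zero =>
      rw [SimpleGraph.Walk.getVert_zero, norm_zero] at h2
      linarith [Nat.cast_nonneg (α := ℝ) n]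
    | succ b =>
      have hedge : ‖p.getVert b - p.getVert (b + 1)‖ ≤ n := not_lt.1 fun hlt =>
        hshort ⟨_, mem_box.2 (by
          rw [sub_zero]
          push_cast
          exact hmin b (by lia)), _, hlt, p.adj_getVert_succ (by lia)⟩
      have hfar : 2 * (n : ℝ) ≤ ‖p.getVert b‖ := by
        have := norm_sub_norm_le (p.getVert (b + 1)) (p.getVert b)
        rw [norm_sub_rev] at this
        linarith
      have hn0 := Nat.cast_nonneg (α := ℝ) n
      refine hslow ⟨p.getVert, 0, b, by lia, fun k _ hk => ?_,
        fun k _ hk => p.adj_getVert_succ (by lia), ?_, ?_⟩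
      · rw [sub_zero]
        exact hmin k (by lia)
      · rw [SimpleGraph.Walk.getVert_zero, zero_sub, norm_neg]
        linarith
      · rw [SimpleGraph.Walk.getVert_zero, zero_sub, norm_neg, Nat.cast_zero, sub_zero]
        have : (b : ℝ) ≤ p.length := by exact_mod_cast (by lia : b ≤ p.length)
        nlinarith
  refine hslow ⟨p.getVert, 0, p.length, by lia, fun k _ hk => ?_,
    fun k _ hk => p.adj_getVert_succ hk, ?_, ?_⟩
  · rw [sub_zero]
    exact hstay _ le_rfl k hk
  · rwa [SimpleGraph.Walk.getVert_zero, SimpleGraph.Walk.getVert_length, zero_sub, norm_neg]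
  · rw [SimpleGraph.Walk.getVert_zero, SimpleGraph.Walk.getVert_length, zero_sub, norm_neg,
      Nat.cast_zero, sub_zero]
    nlinarith

theorem exists_walk_of_graphDist_div_le {ω : ((Fin d → ℤ) → ℝ) × (Sym2 (Fin d → ℤ) → Bool)}
    {η : ℝ} (hη : 0 ≤ η) {x : Fin d → ℤ} (hx : 0 < latticeNorm x)
    (h : graphDist ω 0 x / ENNReal.ofReal (latticeNorm x) ≤ ENNReal.ofReal η) :
    ∃ p : (occupiedGraph ω).Walk 0 x, (p.length : ℝ) ≤ η * latticeNorm x := by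
  rw [ENNReal.div_le_iff (by simpa using hx) ENNReal.ofReal_ne_top, ← ENNReal.ofReal_mul hη,
    graphDist] at h
  have htop : (occupiedGraph ω).edist 0 x ≠ ⊤ := fun htop => by
    rw [htop] at h
    simp at h
  obtain ⟨p, hp⟩ := SimpleGraph.exists_walk_of_edist_ne_top htop
  refine ⟨p, ?_⟩
  rw [← hp, ENat.toENNReal_coe, ← ENNReal.ofReal_natCast] at h
  exact (ENNReal.ofReal_le_ofReal_iff (by positivity)).1 h

theorem tendsto_floor_norm_atTop (hd : 1 ≤ d) :
    Tendsto (fun x : Fin d → ℤ => ⌊‖x‖⌋₊) (comap latticeNorm atTop) atTop := by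
  refine tendsto_nat_floor_atTop.comp ?_
  have hd0 : (0 : ℝ) < d := by exact_mod_cast hd
  refine tendsto_atTop_mono (fun x => ?_) (tendsto_comap.atTop_div_const hd0)
  rw [div_le_iff₀' hd0]
  exact latticeNorm_le x

end ScaleFreePercolation

theorem theorem8 (d : ℕ) (hd : 1 ≤ d) (α β l : ℝ) (hα : 0 < α) (hβ : 0 < β) (hl : 0 < l)
    (h : 2 * (d : ℝ) < min α (β * α)) :
    ∃ η₂ : ℝ, 0 < η₂ ∧
      Tendsto
        (fun x : Fin d → ℤ =>
          ScaleFreePercolation.law d α β l hβ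
            {ω | ENNReal.ofReal η₂ <
              ScaleFreePercolation.graphDist ω 0 x /
                ENNReal.ofReal (ScaleFreePercolation.latticeNorm x)})
        (comap ScaleFreePercolation.latticeNorm atTop) (𝓝 1) := by
  open ScaleFreePercolation in
  obtain ⟨C, s, hC, hs, hedge⟩ := exists_law_edge_le (d := d) hα hβ hl h
  obtain ⟨δ, rfl⟩ : ∃ δ, s = 2 * d + 2 * δ := ⟨(s - 2 * d) / 2, by ring⟩
  have hδ : 0 < δ := by linarith
  obtain ⟨η, hη, hfast⟩ := exists_law_fastEvent_le hβ hC hδ hedge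
  obtain ⟨K, hlong⟩ := exists_law_longEdgeEvent_le hβ hC hδ hedge
  have hd0 : (0 : ℝ) < d := by exact_mod_cast hd
  refine ⟨η / (4 * d), by positivity, ?_⟩
  set μ := law d α β l hβ
  have hlim : Tendsto (fun x : Fin d → ℤ => 1 - ENNReal.ofReal ((1 + K) * (⌊‖x‖⌋₊ : ℝ) ^ (-δ)))
      (comap latticeNorm atTop) (𝓝 1) := by
    have h1 : Tendsto (fun n : ℕ => (1 + K) * (n : ℝ) ^ (-δ)) atTop (𝓝 ((1 + K) * 0)) :=
      ((tendsto_rpow_neg_atTop hδ).comp tendsto_natCast_atTop_atTop).const_mul _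
    rw [mul_zero] at h1
    have h2 := ENNReal.Tendsto.sub (tendsto_const_nhds (x := (1 : ℝ≥0∞)))
      (ENNReal.tendsto_ofReal (h1.comp (tendsto_floor_norm_atTop hd))) (Or.inl ENNReal.one_ne_top)
    simpa using h2
  refine tendsto_of_tendsto_of_tendsto_of_le_of_le' hlim tendsto_const_nhds ?_
    (Eventually.of_forall fun x => prob_le_one)
  filter_upwards [(tendsto_floor_norm_atTop hd).eventually_ge_atTop 1] with x hx1
  have hxn : (⌊‖x‖⌋₊ : ℝ) ≤ ‖x‖ := Nat.floor_le (norm_nonneg x)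
  have hxn' := Nat.lt_floor_add_one ‖x‖
  generalize ⌊‖x‖⌋₊ = n at *
  have hn1 : (1 : ℝ) ≤ n := by exact_mod_cast hx1
  have hnorm : 0 < latticeNorm x := lt_of_lt_of_le (by linarith) (norm_le_latticeNorm x)
  set G := {ω | ENNReal.ofReal (η / (4 * d)) < graphDist ω 0 x / ENNReal.ofReal (latticeNorm x)}
  have hcover : Gᶜ ⊆ fastEvent η n 0 ∪ longEdgeEvent d n := fun ω hω => by
    obtain ⟨p, hp⟩ := exists_walk_of_graphDist_div_le (by positivity) hnorm (not_lt.1 hω)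
    refine mem_fastEvent_or_mem_longEdgeEvent hη.le hxn p (hp.trans_lt ?_)
    calc η / (4 * d) * latticeNorm x ≤ η / (4 * d) * (d * (2 * n)) := by
          gcongr
          refine (latticeNorm_le x).trans ?_
          gcongr
          linarith
      _ = η * n / 2 := by
          field_simp
          norm_num
      _ < η * n := half_lt_self (by positivity)
  have hbad : μ Gᶜ ≤ ENNReal.ofReal ((1 + K) * (n : ℝ) ^ (-δ)) := by
    rw [← ofReal_measureReal (μ := μ)]
    refine ENNReal.ofReal_le_ofReal ((measureReal_mono hcover).trans
      ((measureReal_union_le _ _).trans ?_))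
    rw [add_mul, one_mul]
    exact add_le_add (hfast n hx1 0) (hlong n hx1)
  rw [tsub_le_iff_right]
  calc (1 : ℝ≥0∞) = μ (G ∪ Gᶜ) := by rw [Set.union_compl_self, measure_univ]
    _ ≤ μ G + μ Gᶜ := measure_union_le _ _
    _ ≤ _ := by gcongr
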